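/- A principal-agent instance with $n$ actions and $m$ outcomes consists of outcome distributions $F_a\in\Delta_m$ and efforts $c_a\ge 0$ for the actions $a$ (with $c_a=0$ for at least one action), and rewards $r_\omega\in[0,1]$ for the outcomes $\omega$. Under a contract $p\in[0,1]^m$ an agent of type $\theta\in[0,1]$ plays an action $b^\theta(p)$ that maximizes $\sum_\omega F_{a,\omega}p_\omega-\theta c_a$; ties are broken in favor of the principal, i.e. by maximizing $U^{\mathsf P}(p,a)=\sum_\omega F_{a,\omega}(r_\omega-p_\omega)$ among these actions, and remaining ties by a fixed order of the actions. For a distribution $\Gamma$ of types on $[0,1]$ let $U^{\mathsf P}_\Gamma(p)=\mathbb E_{\theta\sim\Gamma}[U^{\mathsf P}(p,b^\theta(p))]$ and $\mathsf{OPT}_\Gamma=\sup_{p\in[0,1]^m}U^{\mathsf P}_\Gamma(p)$. A learning algorithm knows the instance $(F,c,r)$ and $\beta,\eta,\delta$, but not $\Gamma$. In each round it posts a contract in $[0,1]^m$ that depends on the outcomes of the earlier rounds; a fresh type $\theta\sim\Gamma$ is drawn independently of the past, the agent plays $a=b^\theta(p)$ for the posted contract $p$, and the algorithm observes only the outcome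 $\omega\sim F_a$. After a fixed number $N$ of rounds (samples) it outputs a contract in $[0,1]^m$. Theorem. There are absolute constants $C>0$ and $k,l\in\mathbb N$ such that for every instance with $n$ actions and $m$ outcomes, every $\beta>0$, $\eta>0$ and $\delta\in(0,1]$ there is a (deterministic) learning algorithm that uses $$N\le C\,\frac{(\beta nm)^k}{\eta^4}\,\log^l\!\Big(2+\frac{\beta nm}{\eta}\Big)\,\log\frac{2}{\delta}$$ samples and whose output $p$ satisfies $$\mathbb P\big[\,U^{\mathsf P}_\Gamma(p)\ge \mathsf{OPT}_\Gamma-\eta\,\big]\ge 1-\delta$$ for every type distribution $\Gamma$ on $[0,1]$ that admits a density bounded by $\beta$. -/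

import Mathlib

open MeasureTheory

namespace ContractDesign

/-- A single-dimensional hidden-type principal-agent instance with `n` actions and `m` outcomes:
`F a ω` is the probability that action `a` leads to outcome `ω`, `c a` is the number of units of
effort that action `a` requires, `r ω` is the reward of the principal for outcome `ω`. Some action
requires no effort, so that individual rationality is part of incentive compatibility. -/
structure Instance (n m : ℕ) where
  F : Fin n → Fin m → ℝ
  F_nonneg : ∀ a ω, 0 ≤ F a ω
  F_sum : ∀ a, ∑ ω, F a ω = 1
  c : Fin n → ℝ
  c_nonneg : ∀ a, 0 ≤ c a
  exists_null : ∃ a, c a = 0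
  r : Fin m → ℝ
  r_mem : ∀ ω, r ω ∈ Set.Icc (0 : ℝ) 1

/-- Bounded contracts: payment vectors in `[0,1]^m`. -/
abbrev Contract (m : ℕ) : Type := {p : Fin m → ℝ // ∀ ω, p ω ∈ Set.Icc (0 : ℝ) 1}

namespace Instance

variable {n m : ℕ} (I : Instance n m)

/-- Expected utility of an agent of type `θ` for action `a` under contract `p`. -/
def agentUtility (θ : ℝ) (p : Contract m) (a : Fin n) : ℝ :=
  ∑ ω, I.F a ω * p.1 ω - θ * I.c a

/-- Expected utility of the principal when action `a` is played under contract `p`. -/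
def principalUtility (p : Contract m) (a : Fin n) : ℝ :=
  ∑ ω, I.F a ω * (I.r ω - p.1 ω)

open Classical in
/-- The actions that maximize the expected utility of an agent of type `θ`. -/
noncomputable def bestResponses (θ : ℝ) (p : Contract m) : Finset (Fin n) :=
  Finset.univ.filter fun a => ∀ a', I.agentUtility θ p a' ≤ I.agentUtility θ p a

open Classical in
/-- The best responses that are optimal for the principal among all best responses. -/
noncomputable def favoredResponses (θ : ℝ) (p : Contract m) : Finset (Fin n) :=
  (I.bestResponses θ p).filter fun a =>
    ∀ a' ∈ I.bestResponses θ p, I.principalUtility p a' ≤ I.principalUtility p a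

theorem favoredResponses_nonempty (θ : ℝ) (p : Contract m) :
    (I.favoredResponses θ p).Nonempty := by
  classical
  obtain ⟨a₀, -⟩ := I.exists_null
  obtain ⟨a, -, ha⟩ := Finset.exists_max_image Finset.univ (I.agentUtility θ p)
    ⟨a₀, Finset.mem_univ a₀⟩
  have hne : (I.bestResponses θ p).Nonempty :=
    ⟨a, by simpa [bestResponses] using ha⟩
  obtain ⟨b, hb, hb'⟩ := Finset.exists_max_image (I.bestResponses θ p) (I.principalUtility p) hne
  exact ⟨b, by simpa [favoredResponses] using ⟨hb, hb'⟩⟩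

/-- The action played by an agent of type `θ`: a best response, ties broken in favor of the
principal, and remaining ties by the order of the actions. -/
noncomputable def response (θ : ℝ) (p : Contract m) : Fin n :=
  (I.favoredResponses θ p).min' (I.favoredResponses_nonempty θ p)

/-- Expected utility of the principal for contract `p` when the type is drawn from `Γ`. -/
noncomputable def expectedUtility (Γ : Measure ℝ) (p : Contract m) : ℝ :=
  ∫ θ, I.principalUtility p (I.response θ p) ∂Γ

/-- The value of the optimal contract in `[0,1]^m`. -/
noncomputable def opt (Γ : Measure ℝ) : ℝ :=
  ⨆ p : Contract m, I.expectedUtility Γ p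

/-- The distribution of the outcome when action `a` is played. -/
noncomputable def outcomeLaw (a : Fin n) : Measure (Fin m) :=
  ∑ ω, ENNReal.ofReal (I.F a ω) • Measure.dirac ω

/-- The distribution of the outcome of one round in which contract `p` is posted: a type `θ` is
drawn from `Γ`, the agent plays its response, and the outcome is drawn given the action. -/
noncomputable def roundLaw (Γ : Measure ℝ) (p : Contract m) : Measure (Fin m) :=
  Γ.bind fun θ => I.outcomeLaw (I.response θ p)

end Instance

/-- The probability measure `Γ` of types in `[0,1]` admits a density bounded by `β`. -/
def HasDensityBoundedBy (Γ : Measure ℝ) (β : ℝ) : Prop :=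
  ∃ f : ℝ → ℝ, Measurable f ∧ (∀ θ ∈ Set.Icc (0 : ℝ) 1, 0 ≤ f θ ∧ f θ ≤ β) ∧
    Γ = (volume.restrict (Set.Icc (0 : ℝ) 1)).withDensity fun θ => ENNReal.ofReal (f θ)

/-- A learning algorithm. In round `t` (counted from 0) it posts a contract that depends on the
outcomes of the `t` earlier rounds; after `samples` rounds it stops and outputs a contract. -/
structure Learner (m : ℕ) where
  post : (t : ℕ) → (Fin t → Fin m) → Contract m
  samples : ℕ
  output : (Fin samples → Fin m) → Contract m

/-- The distribution of the outcomes of the first `t` rounds, when the types are drawn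
independently from `Γ`. -/
noncomputable def Learner.historyLaw {n m : ℕ} (L : Learner m) (I : Instance n m)
    (Γ : Measure ℝ) : (t : ℕ) → Measure (Fin t → Fin m)
  | 0 => Measure.dirac Fin.elim0
  | t + 1 => (L.historyLaw I Γ t).bind fun h =>
      (I.roundLaw Γ (L.post t h)).map fun ω => (Fin.snoc h ω : Fin (t + 1) → Fin m)

end ContractDesign

/-!
The learner is nonadaptive. For a contract `p`, the principal's utility as a function of the type
depends only on the effort of the response (`Instance.principalUtility_response_eq_of_cost_eq`),
which is antitone and takes at most `n` values. So if `[0,1]` is cut into `K` cells, the expected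
utility of `p` is a linear functional `∑ k, u p k * Γ (cell k)` of the unknown cell probabilities,
with known coefficients `u p k ∈ [-1,1]` and an error of at most `2 n β / K`
(`Instance.abs_expectedUtility_sub_le`).

Learning all these values at once is a linear regression problem with a small misspecification. By
the elliptic potential argument (`exists_design`) there are about `K / ε²` contracts, up to a
logarithm, such that every `u p` is a linear combination of theirs, up to a residual, with
coefficients and residual of `ℓ²` norm at most `ε`. Posting each of them `R` times and combining the
observed utilities with these coefficients estimates the utility of `p`. Since the `ℓ¹` norm of the
coefficients is of order `√K`, the bias is of order `√K * n β / K`, again up to logarithms, so that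
`K ≈ (n β / η)²` cells suffice; this is where the factor `1 / η ^ 4` in the number of samples comes
from.

The noise is controlled by Hoeffding's lemma and a Chernoff bound (`Learner.historyLaw_real_le`).
The union bound runs over a finite set of contracts, a grid whose points are moved slightly towards
the rewards; it contains a nearly optimal contract for every type distribution
(`Instance.exists_tiltedContract_ge`), and the logarithm of its size is of order `m * log (1 / η)`.
The output is the candidate with the largest estimate.
-/

namespace ContractDesign

/-! ### Experimental design: the elliptic potential argument -/

section Design

open Matrix

variable {ι S : Type*} [DecidableEq ι]

/-- The regularized information matrix `1 + ∑ₛ vₛ vₛᵀ` of a finite family of vectors. -/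
def designMatrix {t : ℕ} (v : Fin t → ι → ℝ) : Matrix ι ι ℝ :=
  1 + ∑ s, vecMulVec (v s) (v s)

theorem designMatrix_snoc {t : ℕ} (v : Fin t → ι → ℝ) (u : ι → ℝ) :
    designMatrix (Fin.snoc v u : Fin (t + 1) → ι → ℝ) = designMatrix v + vecMulVec u u := by
  simp [designMatrix, Fin.sum_univ_castSucc, add_assoc]

variable [Fintype ι]

theorem designMatrix_posDef {t : ℕ} (v : Fin t → ι → ℝ) : (designMatrix v).PosDef := by
  refine PosDef.one.add_posSemidef (posSemidef_sum _ fun s _ => ?_)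
  simpa using posSemidef_vecMulVec_self_star (v s)

theorem designMatrix_mulVec {t : ℕ} (v : Fin t → ι → ℝ) (x : ι → ℝ) (k : ι) :
    (designMatrix v *ᵥ x) k = ∑ s, (v s ⬝ᵥ x) * v s k + x k := by
  simp only [designMatrix, add_mulVec, one_mulVec, sum_mulVec, Pi.add_apply, Finset.sum_apply,
    vecMulVec_mulVec, Pi.smul_apply, MulOpposite.smul_eq_mul_unop, MulOpposite.unop_op]
  rw [add_comm]
  simp only [mul_comm]

theorem det_designMatrix_snoc {t : ℕ} (v : Fin t → ι → ℝ) (u : ι → ℝ) :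
    (designMatrix (Fin.snoc v u : Fin (t + 1) → ι → ℝ)).det =
      (designMatrix v).det * (1 + u ⬝ᵥ ((designMatrix v)⁻¹ *ᵥ u)) := by
  rw [designMatrix_snoc, vecMulVec_eq Unit, det_add_replicateCol_mul_replicateRow
    (designMatrix_posDef v).det_pos.ne'.isUnit]
  rw [Matrix.mul_assoc, ← replicateCol_mulVec,
    det_unique (1 + replicateRow Unit u * _), Matrix.add_apply, one_apply_eq]
  rfl

theorem det_designMatrix_le {t : ℕ} (v : Fin t → ι → ℝ) (hv : ∀ s k, |v s k| ≤ 1) :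
    (designMatrix v).det ≤ (Fintype.card ι * (1 + t)) ^ Fintype.card ι := by
  have hentry : ∀ i j, |designMatrix v i j| ≤ 1 + (t : ℝ) := by
    intro i j
    have h1 : |(1 : Matrix ι ι ℝ) i j| ≤ 1 := by
      by_cases h : i = j <;> simp [Matrix.one_apply, h]
    have h2 : |(∑ s, vecMulVec (v s) (v s)) i j| ≤ t := by
      rw [Matrix.sum_apply]
      refine (Finset.abs_sum_le_sum_abs _ _).trans ?_
      refine (Finset.sum_le_sum (g := fun _ => (1 : ℝ)) fun s _ => ?_).trans (by simp)
      rw [vecMulVec_apply, abs_mul]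
      exact mul_le_one₀ (hv s i) (abs_nonneg _) (hv s j)
    exact (abs_add_le _ _).trans (add_le_add h1 h2)
  have h := Matrix.det_le (abv := AbsoluteValue.abs) (A := designMatrix v) (x := 1 + (t : ℝ))
    hentry
  refine (le_abs_self _).trans (h.trans ?_)
  rw [nsmul_eq_mul, mul_pow]
  gcongr
  exact_mod_cast Nat.factorial_le_pow _

/-- If `T` is large compared with the dimension, then at most `T` vectors of a bounded family
suffice to represent every member of the family with coefficients of small `ℓ²` norm, up to a
residual of small `ℓ²` norm. A family for which this fails at a vector `u` can be extended by `u`,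
which multiplies the determinant of the information matrix by more than `1 + ε²`; the determinant
grows only polynomially, so this happens fewer than `T` times. -/
theorem exists_design (u : S → ι → ℝ) (hu : ∀ p k, |u p k| ≤ 1) {ε : ℝ} (hε : 0 < ε) (hε1 : ε ≤ 1)
    (T : ℕ)
    (hT : 2 * (Fintype.card ι * Real.log (Fintype.card ι * (1 + T))) < T * ε ^ 2) :
    ∃ t ≤ T, ∃ v : Fin t → S, ∀ p, ∃ (a : Fin t → ℝ) (w : ι → ℝ),
      (∀ k, u p k = ∑ s, a s * u (v s) k + w k) ∧ ∑ s, a s ^ 2 + ∑ k, w k ^ 2 ≤ ε ^ 2 := by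
  by_contra! hcon
  have hgrow : ∀ t ≤ T, ∃ v : Fin t → S,
      (1 + ε ^ 2) ^ t ≤ (designMatrix fun s => u (v s)).det := by
    intro t
    induction t with
    | zero => exact fun _ => ⟨Fin.elim0, by simp [designMatrix]⟩
    | succ t ih =>
      intro ht
      obtain ⟨v, hv⟩ := ih (by omega)
      obtain ⟨p, hp⟩ := hcon t (by omega) v
      set A := designMatrix fun s => u (v s) with hA
      set x := A⁻¹ *ᵥ u p with hx
      have hAx : A *ᵥ x = u p := by
        rw [hx, mulVec_mulVec, mul_nonsing_inv _ (designMatrix_posDef _).det_pos.ne'.isUnit,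
          one_mulVec]
      have hrep : ∀ k, u p k = ∑ s, (u (v s) ⬝ᵥ x) * u (v s) k + x k := fun k => by
        rw [← designMatrix_mulVec, ← hA, hAx]
      have hlt := hp _ x hrep
      have hquad : u p ⬝ᵥ x = ∑ s, (u (v s) ⬝ᵥ x) ^ 2 + ∑ k, x k ^ 2 := by
        conv_lhs => rw [dotProduct]
        simp_rw [fun k => congrArg (· * x k) (hrep k), add_mul, Finset.sum_add_distrib,
          Finset.sum_mul]
        rw [Finset.sum_comm]
        congr 1
        · refine Finset.sum_congr rfl fun s _ => ?_
          simp_rw [mul_assoc, ← Finset.mul_sum, sq]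
          rfl
        · simp_rw [sq]
      refine ⟨Fin.snoc v p, ?_⟩
      have hsn : (fun s => u ((Fin.snoc v p : Fin (t + 1) → S) s)) =
          (Fin.snoc (fun s => u (v s)) (u p) : Fin (t + 1) → ι → ℝ) := by
        ext s : 1
        refine Fin.lastCases ?_ (fun i => ?_) s <;> simp
      rw [hsn, det_designMatrix_snoc, pow_succ]
      rw [← hx, hquad]
      exact mul_le_mul hv (by linarith) (by positivity) (designMatrix_posDef _).det_pos.le
  obtain ⟨v, hv⟩ := hgrow T le_rfl
  have hle := hv.trans (det_designMatrix_le _ fun s k => hu (v s) k)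
  have hlog := Real.log_le_log (by positivity) hle
  rw [Real.log_pow, Real.log_pow] at hlog
  have hlow : ε ^ 2 / 2 ≤ Real.log (1 + ε ^ 2) := by
    refine le_trans ?_ (Real.le_log_one_add_of_nonneg (sq_nonneg ε))
    rw [div_le_div_iff₀ (by positivity) (by positivity)]
    nlinarith [sq_nonneg ε, mul_le_one₀ hε1 hε.le hε1]
  nlinarith [mul_le_mul_of_nonneg_left hlow (Nat.cast_nonneg (α := ℝ) T)]

end Design

/-! ### Responses of the agent as a function of the type -/

namespace Instance

variable {n m : ℕ} (I : Instance n m)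

theorem mem_bestResponses {θ : ℝ} {p : Contract m} {a : Fin n} :
    a ∈ I.bestResponses θ p ↔ ∀ a', I.agentUtility θ p a' ≤ I.agentUtility θ p a := by
  simp [bestResponses]

theorem response_mem_favoredResponses (θ : ℝ) (p : Contract m) :
    I.response θ p ∈ I.favoredResponses θ p :=
  Finset.min'_mem _ _

theorem agentUtility_le_response (θ : ℝ) (p : Contract m) (a : Fin n) :
    I.agentUtility θ p a ≤ I.agentUtility θ p (I.response θ p) := by
  have h := I.response_mem_favoredResponses θ p
  rw [favoredResponses, Finset.mem_filter] at h
  exact I.mem_bestResponses.1 h.1 a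

theorem principalUtility_le_response {θ : ℝ} {p : Contract m} {a : Fin n}
    (ha : a ∈ I.bestResponses θ p) :
    I.principalUtility p a ≤ I.principalUtility p (I.response θ p) := by
  have h := I.response_mem_favoredResponses θ p
  rw [favoredResponses, Finset.mem_filter] at h
  exact h.2 a ha

theorem abs_sum_F_mul_le {f : Fin m → ℝ} {x : ℝ} (hf : ∀ ω, |f ω| ≤ x) (a : Fin n) :
    |∑ ω, I.F a ω * f ω| ≤ x := by
  calc |∑ ω, I.F a ω * f ω| ≤ ∑ ω, I.F a ω * x := by
        refine (Finset.abs_sum_le_sum_abs _ _).trans (Finset.sum_le_sum fun ω _ => ?_)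
        rw [abs_mul, abs_of_nonneg (I.F_nonneg a ω)]
        exact mul_le_mul_of_nonneg_left (hf ω) (I.F_nonneg a ω)
    _ = x := by rw [← Finset.sum_mul, I.F_sum, one_mul]

theorem abs_reward_sub_le_one (p : Contract m) (ω : Fin m) : |I.r ω - p.1 ω| ≤ 1 := by
  have h1 := I.r_mem ω
  have h2 := p.2 ω
  rw [Set.mem_Icc] at h1 h2
  rw [abs_le]
  constructor <;> linarith

theorem abs_principalUtility_le_one (p : Contract m) (a : Fin n) :
    |I.principalUtility p a| ≤ 1 :=
  I.abs_sum_F_mul_le (I.abs_reward_sub_le_one p) a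

/-- Agents for whom effort is more expensive exert less effort. -/
theorem antitone_cost_response (p : Contract m) : Antitone fun θ => I.c (I.response θ p) := by
  intro θ₁ θ₂ h
  rcases h.eq_or_lt with rfl | h
  · exact le_rfl
  have h1 := I.agentUtility_le_response θ₁ p (I.response θ₂ p)
  have h2 := I.agentUtility_le_response θ₂ p (I.response θ₁ p)
  simp only [agentUtility] at h1 h2
  by_contra! hc
  nlinarith

theorem principalUtility_response_le_of_cost_eq {θ₁ θ₂ : ℝ} {p : Contract m}
    (h : I.c (I.response θ₁ p) = I.c (I.response θ₂ p)) :
    I.principalUtility p (I.response θ₂ p) ≤ I.principalUtility p (I.response θ₁ p) := by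
  refine I.principalUtility_le_response (I.mem_bestResponses.2 fun a =>
    (I.agentUtility_le_response θ₁ p a).trans ?_)
  have h2 := I.agentUtility_le_response θ₂ p (I.response θ₁ p)
  simp only [agentUtility, h] at h2 ⊢
  linarith

/-- The principal's utility depends on the type only through the effort of the response: actions
of equal effort are either all optimal or all suboptimal together with their expected payment, and
ties among them are broken in the same way for every type. -/
theorem principalUtility_response_eq_of_cost_eq {θ₁ θ₂ : ℝ} {p : Contract m}
    (h : I.c (I.response θ₁ p) = I.c (I.response θ₂ p)) :
    I.principalUtility p (I.response θ₁ p) = I.principalUtility p (I.response θ₂ p) :=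
  le_antisymm (I.principalUtility_response_le_of_cost_eq h.symm)
    (I.principalUtility_response_le_of_cost_eq h)

open Classical in
/-- The number of actions that require less effort than the response of type `θ`. It decreases
whenever the effort of the response does, so its total variation, at most `n`, controls how often
the principal's utility changes with the type. -/
noncomputable def costRank (p : Contract m) (θ : ℝ) : ℕ :=
  (Finset.univ.filter fun a => I.c a < I.c (I.response θ p)).card

theorem costRank_le (p : Contract m) (θ : ℝ) : I.costRank p θ ≤ n :=
  (Finset.card_le_univ _).trans (by simp)

theorem antitone_costRank (p : Contract m) : Antitone (I.costRank p) := by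
  intro θ₁ θ₂ h
  refine Finset.card_le_card fun a ha => ?_
  rw [Finset.mem_filter] at ha ⊢
  exact ⟨ha.1, ha.2.trans_le (I.antitone_cost_response p h)⟩

theorem costRank_lt_of_cost_lt {p : Contract m} {θ₁ θ₂ : ℝ}
    (h : I.c (I.response θ₂ p) < I.c (I.response θ₁ p)) : I.costRank p θ₂ < I.costRank p θ₁ := by
  refine Finset.card_lt_card ((Finset.ssubset_iff_of_subset fun a ha => ?_).2
    ⟨I.response θ₂ p, by simpa using h, by simp⟩)
  rw [Finset.mem_filter] at ha ⊢
  exact ⟨ha.1, ha.2.trans h⟩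

theorem abs_principalUtility_response_sub_le (p : Contract m) {θ₁ θ θ₂ : ℝ} (h₁ : θ₁ ≤ θ)
    (h₂ : θ ≤ θ₂) :
    |I.principalUtility p (I.response θ p) - I.principalUtility p (I.response θ₁ p)| ≤
      2 * ((I.costRank p θ₁ : ℝ) - I.costRank p θ₂) := by
  have hle : (I.costRank p θ₂ : ℝ) ≤ I.costRank p θ := by
    exact_mod_cast I.antitone_costRank p h₂
  have hle' : (I.costRank p θ : ℝ) ≤ I.costRank p θ₁ := by
    exact_mod_cast I.antitone_costRank p h₁
  rcases (I.antitone_cost_response p h₁).eq_or_lt with h | h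
  · rw [I.principalUtility_response_eq_of_cost_eq h, sub_self, abs_zero]
    linarith
  · have hlt : (I.costRank p θ : ℝ) + 1 ≤ I.costRank p θ₁ := by
      exact_mod_cast I.costRank_lt_of_cost_lt h
    have h1 := abs_le.1 (I.abs_principalUtility_le_one p (I.response θ p))
    have h2 := abs_le.1 (I.abs_principalUtility_le_one p (I.response θ₁ p))
    rw [abs_le]
    constructor <;> linarith

theorem measurable_response (p : Contract m) : Measurable fun θ => I.response θ p := by
  have hset : ∀ a, MeasurableSet {θ | a ∈ I.bestResponses θ p} := by
    intro a
    simp only [mem_bestResponses, Set.ofPred_forall]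
    refine MeasurableSet.iInter fun a' => measurableSet_le ?_ ?_ <;>
      · unfold agentUtility
        fun_prop
  refine measurable_to_countable' fun a => ?_
  have hS : ∀ S : Finset (Fin n), MeasurableSet {θ | I.bestResponses θ p = S} := by
    intro S
    simp only [Finset.ext_iff, Set.ofPred_forall]
    refine MeasurableSet.iInter fun a' => ?_
    by_cases h : a' ∈ S
    · simpa [h] using hset a'
    · simp only [h, iff_false]
      exact (hset a').compl
  -- The response depends on the type only through the set of best responses.
  have heq : (fun θ => I.response θ p) ⁻¹' {a} =
      ⋃ S ∈ {S | ∃ θ, I.bestResponses θ p = S ∧ I.response θ p = a},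
        {θ | I.bestResponses θ p = S} := by
    ext θ
    simp only [Set.mem_preimage, Set.mem_singleton_iff, Set.mem_iUnion, Set.mem_ofPred_eq,
      exists_prop, exists_eq_right']
    constructor
    · exact fun h => ⟨θ, rfl, h⟩
    · rintro ⟨θ', h, h'⟩
      rw [← h']
      simp only [response, favoredResponses, h]
  rw [heq]
  exact MeasurableSet.biUnion (Set.to_countable _) fun S _ => hS S

theorem measurable_principalUtility_response (p : Contract m) :
    Measurable fun θ => I.principalUtility p (I.response θ p) :=
  (measurable_from_top (f := I.principalUtility p)).comp (I.measurable_response p)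

theorem integrable_principalUtility_response (Γ : Measure ℝ) [IsFiniteMeasure Γ]
    (p : Contract m) : Integrable (fun θ => I.principalUtility p (I.response θ p)) Γ :=
  Integrable.of_bound (I.measurable_principalUtility_response p).aestronglyMeasurable 1
    (ae_of_all _ fun θ => I.abs_principalUtility_le_one p (I.response θ p))

theorem abs_expectedUtility_le_one (Γ : Measure ℝ) [IsProbabilityMeasure Γ] (p : Contract m) :
    |I.expectedUtility Γ p| ≤ 1 := by
  have h := norm_integral_le_of_norm_le_const (μ := Γ) (C := 1)
    (f := fun θ => I.principalUtility p (I.response θ p))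
    (ae_of_all _ fun θ => I.abs_principalUtility_le_one p (I.response θ p))
  simpa [expectedUtility] using h

end Instance

/-! ### Discretization of the type space -/

theorem HasDensityBoundedBy.apply_le {Γ : Measure ℝ} {β : ℝ} (h : HasDensityBoundedBy Γ β)
    (s : Set ℝ) : Γ s ≤ ENNReal.ofReal β * volume s := by
  obtain ⟨f, -, hf, rfl⟩ := h
  have hle : ((volume.restrict (Set.Icc (0 : ℝ) 1)).withDensity fun θ => ENNReal.ofReal (f θ)) ≤
      ENNReal.ofReal β • volume := by
    refine (withDensity_mono (g := fun _ => ENNReal.ofReal β) ?_).trans ?_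
    · filter_upwards [ae_restrict_mem measurableSet_Icc] with θ hθ
      exact ENNReal.ofReal_le_ofReal (hf θ hθ).2
    · rw [withDensity_const]
      gcongr
      exact Measure.restrict_le_self
  exact hle s

theorem HasDensityBoundedBy.ae_mem_Icc {Γ : Measure ℝ} {β : ℝ} (h : HasDensityBoundedBy Γ β) :
    ∀ᵐ θ ∂Γ, θ ∈ Set.Icc (0 : ℝ) 1 := by
  obtain ⟨f, -, hf, rfl⟩ := h
  exact (withDensity_absolutelyContinuous _ _).ae_le (ae_restrict_mem measurableSet_Icc)

/-- A probability measure on `[0,1]` has no density bounded by a number less than `1`. -/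
theorem HasDensityBoundedBy.one_le {Γ : Measure ℝ} [IsProbabilityMeasure Γ] {β : ℝ}
    (h : HasDensityBoundedBy Γ β) : 1 ≤ β := by
  have h1 : Γ (Set.Icc 0 1) = 1 := by
    rw [prob_compl_eq_zero_iff measurableSet_Icc |>.1]
    exact h.ae_mem_Icc
  have h2 := h.apply_le (Set.Icc 0 1)
  rw [h1] at h2
  simpa using h2

/-- The cell `[k/K, (k+1)/K)` of types. -/
def typeCell (K k : ℕ) : Set ℝ := Set.Ico (k / K : ℝ) ((k + 1 : ℕ) / K : ℝ)

theorem measurableSet_typeCell (K k : ℕ) : MeasurableSet (typeCell K k) := measurableSet_Ico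

theorem disjoint_typeCell {K k k' : ℕ} (h : k ≠ k') : Disjoint (typeCell K k) (typeCell K k') := by
  wlog hlt : k < k' generalizing k k'
  · exact (this h.symm (by omega)).symm
  rw [Set.disjoint_left]
  intro θ h1 h2
  have hle : ((k + 1 : ℕ) / K : ℝ) ≤ k' / K := by
    gcongr
    exact hlt
  exact absurd h1.2 (not_lt.2 (hle.trans h2.1))

/-- The last cell, with `k = K`, is needed only for the type `1`. -/
theorem Icc_subset_iUnion_typeCell {K : ℕ} (hK : 0 < K) :
    Set.Icc (0 : ℝ) 1 ⊆ ⋃ k : Fin (K + 1), typeCell K k := by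
  intro θ hθ
  have hK' : (0 : ℝ) < K := by exact_mod_cast hK
  have h0 : 0 ≤ θ * K := mul_nonneg hθ.1 hK'.le
  have hlt : ⌊θ * K⌋₊ < K + 1 := by
    refine Nat.lt_succ_of_le (Nat.floor_le_of_le ?_)
    nlinarith [hθ.2]
  refine Set.mem_iUnion.2 ⟨⟨⌊θ * K⌋₊, hlt⟩, ?_, ?_⟩
  · rw [div_le_iff₀ hK']
    exact Nat.floor_le h0
  · rw [lt_div_iff₀ hK']
    push_cast
    exact Nat.lt_floor_add_one _

theorem HasDensityBoundedBy.real_typeCell_le {Γ : Measure ℝ} {β : ℝ}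
    (h : HasDensityBoundedBy Γ β) (hβ : 0 ≤ β) {K : ℕ} (hK : 0 < K) (k : ℕ) :
    Γ.real (typeCell K k) ≤ β / K := by
  have hK' : (0 : ℝ) < K := by exact_mod_cast hK
  have h1 := h.apply_le (typeCell K k)
  have hlen : ((k + 1 : ℕ) / K : ℝ) - k / K = 1 / K := by
    push_cast
    ring
  rw [typeCell, Real.volume_Ico, hlen, ← ENNReal.ofReal_mul hβ, mul_one_div] at h1
  exact ENNReal.toReal_le_of_le_ofReal (by positivity) h1

theorem sum_real_typeCell_le_one (Γ : Measure ℝ) [IsProbabilityMeasure Γ] (K : ℕ) :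
    ∑ k : Fin (K + 1), Γ.real (typeCell K k) ≤ 1 := by
  rw [← measureReal_iUnion_fintype (f := fun k : Fin (K + 1) => typeCell K k)
    (fun i j hij => disjoint_typeCell (Fin.val_injective.ne hij))
    (fun k => measurableSet_typeCell K k)]
  exact measureReal_le_one

/-- The utility of the principal at the left end of each cell of types. -/
noncomputable def Instance.cellUtility {n m : ℕ} (I : Instance n m) (K : ℕ) (p : Contract m)
    (k : Fin (K + 1)) : ℝ :=
  I.principalUtility p (I.response (k / K) p)

/-- The expected utility is a linear functional of the probabilities of the cells, up to an error
that comes from the at most `n` cells in which the response changes. -/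
theorem Instance.abs_expectedUtility_sub_le {n m : ℕ} (I : Instance n m) {Γ : Measure ℝ}
    [IsProbabilityMeasure Γ] {β : ℝ} (h : HasDensityBoundedBy Γ β) {K : ℕ} (hK : 0 < K)
    (p : Contract m) :
    |I.expectedUtility Γ p - ∑ k, I.cellUtility K p k * Γ.real (typeCell K k)| ≤
      2 * n * β / K := by
  have hβ : 0 ≤ β := zero_le_one.trans h.one_le
  have hcell : ∀ k : Fin (K + 1),
      |∫ θ in typeCell K k, I.principalUtility p (I.response θ p) ∂Γ -
        I.cellUtility K p k * Γ.real (typeCell K k)| ≤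
      2 * ((I.costRank p ((k : ℕ) / K) : ℝ) - I.costRank p ((k + 1 : ℕ) / K)) * (β / K) := by
    intro k
    have hint := (I.integrable_principalUtility_response Γ p).integrableOn (s := typeCell K k)
    have hmono : (I.costRank p ((k + 1 : ℕ) / K) : ℝ) ≤ I.costRank p ((k : ℕ) / K) := by
      refine Nat.cast_le.2 (I.antitone_costRank p ?_)
      gcongr
      omega
    have hsub : ∫ θ in typeCell K k, I.principalUtility p (I.response θ p) ∂Γ -
          I.cellUtility K p k * Γ.real (typeCell K k) =
        ∫ θ in typeCell K k, (I.principalUtility p (I.response θ p) - I.cellUtility K p k) ∂Γ := by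
      rw [integral_sub hint (integrable_const _), setIntegral_const, smul_eq_mul, mul_comm]
    rw [hsub]
    refine (norm_setIntegral_le_of_norm_le_const
      (f := fun θ => I.principalUtility p (I.response θ p) - I.cellUtility K p k)
      (measure_lt_top Γ _) fun θ hθ =>
        I.abs_principalUtility_response_sub_le p hθ.1 hθ.2.le).trans ?_
    exact mul_le_mul_of_nonneg_left (h.real_typeCell_le hβ hK k) (by linarith)
  have hsplit : I.expectedUtility Γ p =
      ∑ k : Fin (K + 1), ∫ θ in typeCell K k, I.principalUtility p (I.response θ p) ∂Γ := by
    rw [← integral_iUnion_fintype (s := fun k : Fin (K + 1) => typeCell K k)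
      (fun k => measurableSet_typeCell K k)
      (fun i j hij => disjoint_typeCell (Fin.val_injective.ne hij))
      fun k => (I.integrable_principalUtility_response Γ p).integrableOn]
    rw [setIntegral_eq_integral_of_ae_compl_eq_zero, expectedUtility]
    filter_upwards [h.ae_mem_Icc] with θ hθ hθ'
    exact absurd (Icc_subset_iUnion_typeCell hK hθ) hθ'
  rw [hsplit, ← Finset.sum_sub_distrib]
  refine (Finset.abs_sum_le_sum_abs _ _).trans ((Finset.sum_le_sum fun k _ => hcell k).trans ?_)
  rw [← Finset.sum_mul, ← Finset.mul_sum,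
    Fin.sum_univ_eq_sum_range (fun k : ℕ =>
      (I.costRank p (k / K) : ℝ) - I.costRank p ((k + 1 : ℕ) / K)) (K + 1),
    Finset.sum_range_sub' (fun k : ℕ => (I.costRank p (k / K) : ℝ))]
  have h0 : (I.costRank p ((0 : ℕ) / K) : ℝ) ≤ n := by exact_mod_cast I.costRank_le p _
  have h1 : (0 : ℝ) ≤ I.costRank p ((K + 1 : ℕ) / K) := Nat.cast_nonneg _
  calc _ ≤ 2 * (n : ℝ) * (β / K) := by
        gcongr
        linarith
    _ = 2 * n * β / K := by ring

/-! ### A finite set of contracts that is nearly optimal for every type -/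

namespace Instance

variable {n m : ℕ} (I : Instance n m)

theorem one_sub_mul_add_mem_Icc {N : ℕ} {x y : ℝ} (hx : x ∈ Set.Icc (0 : ℝ) 1)
    (hy : y ∈ Set.Icc (0 : ℝ) 1) :
    (1 - 1 / (N : ℝ)) * x + 1 / (N : ℝ) * y ∈ Set.Icc (0 : ℝ) 1 := by
  have h1 : 1 / (N : ℝ) ≤ 1 := by
    rcases Nat.eq_zero_or_pos N with rfl | h
    · simp
    · exact div_le_one_of_le₀ (by exact_mod_cast h) (by positivity)
  exact convex_Icc (0 : ℝ) 1 hx hy (sub_nonneg.2 h1) (by positivity : 0 ≤ 1 / (N : ℝ))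
    (sub_add_cancel _ _)

/-- The contract on the grid of mesh `1 / N ^ 2` with index `g`, moved towards the rewards by the
fraction `1 / N`. Moving towards the rewards makes an agent who is almost indifferent between two
actions choose the one that is better for the principal. -/
noncomputable def tiltedContract (N : ℕ) (g : Fin m → Fin (N ^ 2 + 1)) : Contract m :=
  ⟨fun ω => (1 - 1 / (N : ℝ)) * ((g ω : ℕ) / (N : ℝ) ^ 2) + 1 / (N : ℝ) * I.r ω, fun ω =>
    one_sub_mul_add_mem_Icc ⟨by positivity, div_le_one_of_le₀
      (by exact_mod_cast Nat.lt_succ_iff.1 (g ω).2) (by positivity)⟩ (I.r_mem ω)⟩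

/-- Rounding a contract down to the grid and moving it towards the rewards costs the principal at
most `2 / N`, whatever the type: the rounding changes the agent's utilities by at most `1 / N ^ 2`,
so by incentive compatibility the new response `a'` and the old response `a` satisfy
`F a' ⬝ (r - p₀) ≥ F a ⬝ (r - p₀) - 1 / N` for the rounded contract `p₀`. -/
theorem exists_tiltedContract_ge {N : ℕ} (hN : 0 < N) (p : Contract m) :
    ∃ g, ∀ θ, I.principalUtility p (I.response θ p) - 2 / N ≤
      I.principalUtility (I.tiltedContract N g) (I.response θ (I.tiltedContract N g)) := by
  have hN' : (0 : ℝ) < N := by exact_mod_cast hN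
  have hN2 : (0 : ℝ) < (N : ℝ) ^ 2 := by positivity
  have hfloor : ∀ ω, ⌊p.1 ω * (N : ℝ) ^ 2⌋₊ < N ^ 2 + 1 := fun ω => by
    refine Nat.lt_succ_of_le (Nat.floor_le_of_le ?_)
    push_cast
    nlinarith [(p.2 ω).2]
  set g : Fin m → Fin (N ^ 2 + 1) := fun ω => ⟨⌊p.1 ω * (N : ℝ) ^ 2⌋₊, hfloor ω⟩ with hg
  set p₀ : Fin m → ℝ := fun ω => (g ω : ℕ) / (N : ℝ) ^ 2 with hp₀
  have hp₀0 : ∀ ω, 0 ≤ p₀ ω := fun ω => by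
    simp only [hp₀]
    positivity
  have hle : ∀ ω, p₀ ω ≤ p.1 ω := fun ω => by
    simp only [hp₀, hg]
    rw [div_le_iff₀ hN2]
    exact Nat.floor_le (mul_nonneg (p.2 ω).1 hN2.le)
  have hge : ∀ ω, p.1 ω - (1 / (N : ℝ)) ^ 2 ≤ p₀ ω := fun ω => by
    simp only [hp₀, hg]
    rw [le_div_iff₀ hN2, sub_mul, one_div, inv_pow, inv_mul_cancel₀ hN2.ne']
    exact (Nat.sub_one_lt_floor _).le
  refine ⟨g, fun θ => ?_⟩
  set q := I.tiltedContract N g with hq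
  set α : ℝ := 1 / (N : ℝ) with hα
  have hα0 : 0 < α := by positivity
  have hqval : ∀ ω, q.1 ω = (1 - α) * p₀ ω + α * I.r ω := fun ω => rfl
  set a := I.response θ p
  set a' := I.response θ q
  have h1 := I.agentUtility_le_response θ p a'
  have h2 := I.agentUtility_le_response θ q a
  have hqsum : ∀ b, ∑ ω, I.F b ω * q.1 ω =
      (1 - α) * ∑ ω, I.F b ω * p₀ ω + α * ∑ ω, I.F b ω * I.r ω := fun b => by
    rw [Finset.mul_sum, Finset.mul_sum, ← Finset.sum_add_distrib]
    exact Finset.sum_congr rfl fun ω _ => by rw [hqval]; ring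
  have hup : ∀ b, ∑ ω, I.F b ω * p₀ ω ≤ ∑ ω, I.F b ω * p.1 ω := fun b =>
    Finset.sum_le_sum fun ω _ => mul_le_mul_of_nonneg_left (hle ω) (I.F_nonneg b ω)
  have hlow : ∀ b, ∑ ω, I.F b ω * p.1 ω - α ^ 2 ≤ ∑ ω, I.F b ω * p₀ ω := fun b => by
    calc ∑ ω, I.F b ω * p.1 ω - α ^ 2 = ∑ ω, I.F b ω * (p.1 ω - α ^ 2) := by
          simp_rw [mul_sub]
          rw [Finset.sum_sub_distrib, ← Finset.sum_mul, I.F_sum, one_mul]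
      _ ≤ _ := Finset.sum_le_sum fun ω _ => mul_le_mul_of_nonneg_left (hge ω) (I.F_nonneg b ω)
  have hbd : ∑ ω, I.F a' ω * I.r ω - ∑ ω, I.F a' ω * p₀ ω ≤ 1 := by
    rw [← Finset.sum_sub_distrib]
    simp_rw [← mul_sub]
    refine (le_abs_self _).trans (I.abs_sum_F_mul_le (fun ω => ?_) a')
    rw [abs_le]
    constructor <;> linarith [(I.r_mem ω).1, (I.r_mem ω).2, hp₀0 ω, hle ω, (p.2 ω).2]
  have hU : ∀ (b : Fin n) (c : Contract m), I.principalUtility c b =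
      ∑ ω, I.F b ω * I.r ω - ∑ ω, I.F b ω * c.1 ω := fun b c => by
    simp_rw [principalUtility, mul_sub, Finset.sum_sub_distrib]
  simp only [agentUtility, hqsum] at h1 h2
  rw [hU, hU, hqsum, show (2 : ℝ) / N = 2 * α by rw [hα]; ring]
  have ha := hup a
  have ha' := hup a'
  have hla := hlow a
  generalize ∑ ω, I.F a ω * I.r ω = R at *
  generalize ∑ ω, I.F a' ω * I.r ω = R' at *
  generalize ∑ ω, I.F a ω * p.1 ω = P at *
  generalize ∑ ω, I.F a' ω * p.1 ω = P' at *
  generalize ∑ ω, I.F a ω * p₀ ω = Q at *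
  generalize ∑ ω, I.F a' ω * p₀ ω = Q' at *
  have hkey : R - Q - α ≤ R' - Q' := by
    refine le_of_mul_le_mul_left ?_ hα0
    nlinarith
  nlinarith

end Instance

/-! ### Concentration of the observed utilities -/

namespace Instance

variable {n m : ℕ} (I : Instance n m)

theorem outcomeLaw_singleton (a : Fin n) (ω : Fin m) :
    I.outcomeLaw a {ω} = ENNReal.ofReal (I.F a ω) := by
  simp [outcomeLaw, Measure.finsetSum_apply, Set.indicator_apply]

theorem outcomeLaw_univ (a : Fin n) : I.outcomeLaw a Set.univ = 1 := by
  simp [outcomeLaw, Measure.finsetSum_apply,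
    ← ENNReal.ofReal_sum_of_nonneg fun ω _ => I.F_nonneg a ω, I.F_sum]

theorem measurable_outcomeLaw_response (p : Contract m) :
    Measurable fun θ => I.outcomeLaw (I.response θ p) :=
  (measurable_from_top (f := I.outcomeLaw)).comp (I.measurable_response p)

instance isProbabilityMeasure_roundLaw (Γ : Measure ℝ) [IsProbabilityMeasure Γ]
    (p : Contract m) : IsProbabilityMeasure (I.roundLaw Γ p) := by
  refine ⟨?_⟩
  rw [roundLaw, Measure.bind_apply MeasurableSet.univ
    (I.measurable_outcomeLaw_response p).aemeasurable]
  simp [outcomeLaw_univ]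

theorem integrable_F_response (Γ : Measure ℝ) [IsProbabilityMeasure Γ] (p : Contract m)
    (ω : Fin m) : Integrable (fun θ => I.F (I.response θ p) ω) Γ := by
  refine Integrable.of_bound ((measurable_from_top (f := fun a => I.F a ω)).comp
    (I.measurable_response p)).aestronglyMeasurable 1 (ae_of_all _ fun θ => ?_)
  rw [Real.norm_eq_abs, abs_of_nonneg (I.F_nonneg _ _), ← I.F_sum (I.response θ p)]
  exact Finset.single_le_sum (fun ω _ => I.F_nonneg _ ω) (Finset.mem_univ ω)

theorem roundLaw_real_singleton (Γ : Measure ℝ) [IsProbabilityMeasure Γ] (p : Contract m)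
    (ω : Fin m) : (I.roundLaw Γ p).real {ω} = ∫ θ, I.F (I.response θ p) ω ∂Γ := by
  rw [measureReal_def, roundLaw, Measure.bind_apply (measurableSet_singleton ω)
    (I.measurable_outcomeLaw_response p).aemeasurable]
  simp_rw [outcomeLaw_singleton]
  rw [← ofReal_integral_eq_lintegral_ofReal (I.integrable_F_response Γ p ω)
    (ae_of_all _ fun θ => I.F_nonneg _ _),
    ENNReal.toReal_ofReal (integral_nonneg fun θ => I.F_nonneg _ _)]

/-- The observed utility of the principal in a round is an unbiased estimate of its expected
utility. -/
theorem integral_roundLaw (Γ : Measure ℝ) [IsProbabilityMeasure Γ] (p : Contract m) :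
    ∫ ω, (I.r ω - p.1 ω) ∂(I.roundLaw Γ p) = I.expectedUtility Γ p := by
  rw [integral_fintype .of_finite, expectedUtility]
  simp_rw [principalUtility, roundLaw_real_singleton]
  rw [integral_finsetSum _ fun ω _ => (I.integrable_F_response Γ p ω).mul_const _]
  exact Finset.sum_congr rfl fun ω _ => by rw [integral_mul_const, smul_eq_mul]

theorem lintegral_exp_roundLaw_le (Γ : Measure ℝ) [IsProbabilityMeasure Γ] (p : Contract m)
    (x : ℝ) :
    ∫⁻ ω, ENNReal.ofReal (Real.exp (x * (I.r ω - p.1 ω - I.expectedUtility Γ p)))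
      ∂(I.roundLaw Γ p) ≤ ENNReal.ofReal (Real.exp (x ^ 2 / 2)) := by
  have h := ProbabilityTheory.hasSubgaussianMGF_of_mem_Icc (μ := I.roundLaw Γ p)
    (X := fun ω => I.r ω - p.1 ω) (a := -1) (b := 1) (measurable_of_finite _).aemeasurable
    (ae_of_all _ fun ω => abs_le.1 (I.abs_reward_sub_le_one p ω))
  have h2 := h.mgf_le x
  rw [I.integral_roundLaw] at h2
  rw [← ofReal_integral_eq_lintegral_ofReal .of_finite (ae_of_all _ fun ω => (Real.exp_pos _).le)]
  refine ENNReal.ofReal_le_ofReal (h2.trans_eq ?_)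
  norm_num

end Instance

namespace Learner

variable {n m : ℕ} (L : Learner m) (I : Instance n m)

instance isProbabilityMeasure_historyLaw (Γ : Measure ℝ) [IsProbabilityMeasure Γ] (t : ℕ) :
    IsProbabilityMeasure (L.historyLaw I Γ t) := by
  induction t with
  | zero =>
    rw [historyLaw]
    infer_instance
  | succ t ih =>
    refine ⟨?_⟩
    rw [historyLaw, Measure.bind_apply MeasurableSet.univ (measurable_of_finite _).aemeasurable]
    have : ∀ h : Fin t → Fin m, ((I.roundLaw Γ (L.post t h)).map fun ω =>
        (Fin.snoc h ω : Fin (t + 1) → Fin m)) Set.univ = 1 := fun h => by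
      rw [Measure.map_apply (measurable_of_finite _) MeasurableSet.univ]
      simp
    simp [this]

variable {L} {q : ℕ → Contract m}

theorem lintegral_exp_historyLaw_le (hL : ∀ t h, L.post t h = q t) (Γ : Measure ℝ)
    [IsProbabilityMeasure Γ] (x : ℕ → ℝ) (t : ℕ) :
    ∫⁻ h, ENNReal.ofReal (Real.exp (∑ s : Fin t,
        x s * (I.r (h s) - (q s).1 (h s) - I.expectedUtility Γ (q s)))) ∂(L.historyLaw I Γ t) ≤
      ENNReal.ofReal (Real.exp (∑ s : Fin t, x s ^ 2 / 2)) := by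
  induction t with
  | zero => simp [historyLaw]
  | succ t ih =>
    rw [historyLaw, Measure.lintegral_bind (measurable_of_finite _).aemeasurable
      (measurable_of_finite _).aemeasurable]
    simp_rw [hL, lintegral_map (measurable_of_finite _) (measurable_of_finite _),
      Fin.sum_univ_castSucc, Fin.snoc_castSucc, Fin.snoc_last, Real.exp_add,
      ENNReal.ofReal_mul (Real.exp_pos _).le, Fin.val_castSucc, Fin.val_last]
    simp_rw [lintegral_const_mul _ (measurable_of_finite _)]
    rw [lintegral_mul_const _ (measurable_of_finite _)]
    exact mul_le_mul' ih (I.lintegral_exp_roundLaw_le Γ (q t) (x t))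

/-- A Chernoff bound for weighted sums of observed utilities, for a learner whose posted contracts
do not depend on the history. -/
theorem historyLaw_real_le (hL : ∀ t h, L.post t h = q t) (Γ : Measure ℝ)
    [IsProbabilityMeasure Γ] (x : ℕ → ℝ) (t : ℕ) {V ε : ℝ} (hV : 0 < V) (hε : 0 ≤ ε)
    (hx : ∑ s : Fin t, x s ^ 2 ≤ V) :
    (L.historyLaw I Γ t).real {h | ε ≤ ∑ s : Fin t,
        x s * (I.r (h s) - (q s).1 (h s) - I.expectedUtility Γ (q s))} ≤
      Real.exp (-(ε ^ 2 / (2 * V))) := by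
  have hE := lintegral_exp_historyLaw_le I hL Γ (fun s => ε / V * x s) t
  have hsub : {h : Fin t → Fin m | ε ≤ ∑ s : Fin t,
        x s * (I.r (h s) - (q s).1 (h s) - I.expectedUtility Γ (q s))} ⊆
      {h | ENNReal.ofReal (Real.exp (ε / V * ε)) ≤ ENNReal.ofReal (Real.exp (∑ s : Fin t,
        ε / V * x s * (I.r (h s) - (q s).1 (h s) - I.expectedUtility Γ (q s))))} := by
    intro h hh
    refine ENNReal.ofReal_le_ofReal (Real.exp_le_exp.2 ?_)
    simp_rw [mul_assoc, ← Finset.mul_sum]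
    exact mul_le_mul_of_nonneg_left hh (by positivity)
  have hM := (mul_meas_ge_le_lintegral₀ (μ := L.historyLaw I Γ t)
    (measurable_of_finite _).aemeasurable (ENNReal.ofReal (Real.exp (ε / V * ε)))).trans hE
  have hM' := ENNReal.toReal_mono ENNReal.ofReal_ne_top
    ((mul_le_mul_right (measure_mono hsub) _).trans hM)
  rw [ENNReal.toReal_mul, ENNReal.toReal_ofReal (Real.exp_pos _).le,
    ENNReal.toReal_ofReal (Real.exp_pos _).le, ← measureReal_def, ← le_div_iff₀' (Real.exp_pos _),
    ← Real.exp_sub] at hM'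
  refine hM'.trans (Real.exp_le_exp.2 ?_)
  have hsum : ∑ s : Fin t, (ε / V * x s) ^ 2 / 2 ≤ (ε / V) ^ 2 / 2 * V := by
    calc ∑ s : Fin t, (ε / V * x s) ^ 2 / 2 = (ε / V) ^ 2 / 2 * ∑ s : Fin t, x s ^ 2 := by
          rw [Finset.mul_sum]
          exact Finset.sum_congr rfl fun s _ => by ring
      _ ≤ _ := mul_le_mul_of_nonneg_left hx (by positivity)
  refine (sub_le_sub_right hsum _).trans_eq ?_
  field_simp
  ring

end Learner

/-! ### The learning algorithm -/

theorem sum_divNat {t R : ℕ} (f : Fin t → ℝ) :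
    ∑ s : Fin (t * R), f s.divNat = R * ∑ i, f i := by
  rw [← Equiv.sum_comp finProdFinEquiv, Fintype.sum_prod_type, Finset.mul_sum]
  refine Finset.sum_congr rfl fun i _ => ?_
  have h : ∀ j : Fin R, (finProdFinEquiv (i, j)).divNat = i := fun j =>
    congrArg Prod.fst (finProdFinEquiv.symm_apply_apply (i, j))
  simp [h]

/-- If the cell utilities of `q` are represented by those of the design contracts `v i`, then so is
its expected utility. The discretization errors of the design contracts are weighted by `a`, whose
`ℓ¹` norm is at most `√t * ε`. -/
theorem Instance.abs_sum_expectedUtility_sub_le {n m : ℕ} (I : Instance n m) {Γ : Measure ℝ}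
    [IsProbabilityMeasure Γ] {β : ℝ} (h : HasDensityBoundedBy Γ β) {K : ℕ} (hK : 0 < K) {t : ℕ}
    {ε : ℝ} (hε : 0 ≤ ε) (q : Contract m) (v : Fin t → Contract m) (a : Fin t → ℝ)
    (w : Fin (K + 1) → ℝ)
    (hrep : ∀ k, I.cellUtility K q k = ∑ i, a i * I.cellUtility K (v i) k + w k)
    (haw : ∑ i, a i ^ 2 + ∑ k, w k ^ 2 ≤ ε ^ 2) :
    |∑ i, a i * I.expectedUtility Γ (v i) - I.expectedUtility Γ q| ≤
      (√t * ε + 1) * (2 * n * β / K) + ε := by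
  set γ : Fin (K + 1) → ℝ := fun k => Γ.real (typeCell K k)
  set err : ℝ := 2 * n * β / K
  have herr : ∀ p, |I.expectedUtility Γ p - ∑ k, I.cellUtility K p k * γ k| ≤ err :=
    fun p => I.abs_expectedUtility_sub_le h hK p
  have herr0 : 0 ≤ err := (abs_nonneg _).trans (herr q)
  have hw0 : 0 ≤ ∑ k, w k ^ 2 := Finset.sum_nonneg fun k _ => sq_nonneg _
  have ha0 : 0 ≤ ∑ i, a i ^ 2 := Finset.sum_nonneg fun i _ => sq_nonneg _
  have hl1 : ∑ i, |a i| ≤ √t * ε := by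
    have hcs : (∑ i, |a i|) ^ 2 ≤ t * ∑ i, a i ^ 2 := by
      simpa using sq_sum_le_card_mul_sum_sq (s := Finset.univ) (f := fun i => |a i|)
    refine abs_le_of_sq_le_sq' ?_ (by positivity) |>.2
    rw [mul_pow, Real.sq_sqrt (Nat.cast_nonneg t)]
    exact hcs.trans (mul_le_mul_of_nonneg_left (by linarith) (Nat.cast_nonneg t))
  have hmis : |∑ i, a i * (I.expectedUtility Γ (v i) - ∑ k, I.cellUtility K (v i) k * γ k)| ≤
      √t * ε * err := by
    refine (Finset.abs_sum_le_sum_abs _ _).trans (le_trans ?_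
      (mul_le_mul_of_nonneg_right hl1 herr0))
    rw [Finset.sum_mul]
    refine Finset.sum_le_sum fun i _ => ?_
    rw [abs_mul]
    exact mul_le_mul_of_nonneg_left (herr (v i)) (abs_nonneg _)
  have hres : |∑ k, w k * γ k| ≤ ε := by
    calc |∑ k, w k * γ k| ≤ ∑ k, ε * γ k := by
          refine (Finset.abs_sum_le_sum_abs _ _).trans (Finset.sum_le_sum fun k _ => ?_)
          rw [abs_mul, abs_of_nonneg (measureReal_nonneg : 0 ≤ γ k)]
          refine mul_le_mul_of_nonneg_right (abs_le_of_sq_le_sq ?_ hε) measureReal_nonneg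
          have := Finset.single_le_sum (fun k _ => sq_nonneg (w k)) (Finset.mem_univ k)
          linarith
      _ ≤ ε * 1 := by
          rw [← Finset.mul_sum]
          exact mul_le_mul_of_nonneg_left (sum_real_typeCell_le_one Γ K) hε
      _ = ε := mul_one ε
  have hdecomp : ∑ i, a i * I.expectedUtility Γ (v i) - I.expectedUtility Γ q =
      ∑ i, a i * (I.expectedUtility Γ (v i) - ∑ k, I.cellUtility K (v i) k * γ k) -
        ∑ k, w k * γ k - (I.expectedUtility Γ q - ∑ k, I.cellUtility K q k * γ k) := by
    have hq : ∑ k, I.cellUtility K q k * γ k =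
        ∑ i, a i * ∑ k, I.cellUtility K (v i) k * γ k + ∑ k, w k * γ k := by
      simp_rw [hrep, add_mul, Finset.sum_add_distrib, Finset.sum_mul, Finset.mul_sum]
      rw [Finset.sum_comm]
      simp_rw [mul_assoc]
    simp_rw [mul_sub, Finset.sum_sub_distrib]
    linarith
  have hq := abs_le.1 (herr q)
  rw [abs_le] at hmis hres
  rw [hdecomp, abs_le]
  constructor <;> linarith

/-- The learner for generic values of the parameters: `K` is the number of cells of types, `N` is
the resolution of the set of candidate contracts, `T` bounds the size of the design, and every
contract of the design is posted `R` times. The output maximizes, among the candidates, the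
estimate of the utility that results from their representations by the design. -/
theorem Instance.exists_learner {n m : ℕ} (I : Instance n m) {β ε δ : ℝ} (hε : 0 < ε) (hε1 : ε ≤ 1)
    {K N T R : ℕ} (hK : 0 < K) (hN : 0 < N) (hR : 0 < R)
    (hdesign : 2 * ((K + 1 : ℕ) * Real.log ((K + 1 : ℕ) * (1 + T))) < T * ε ^ 2)
    (hbias : (√T * ε + 1) * (2 * n * β / K) ≤ 2 * ε) (hgrid : 2 / (N : ℝ) ≤ 4 * ε)
    (hnoise : ((N : ℝ) ^ 2 + 1) ^ m * (2 * Real.exp (-(R / 2 : ℝ))) ≤ δ) :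
    ∃ L : Learner m, L.samples ≤ T * R ∧ ∀ Γ : Measure ℝ, IsProbabilityMeasure Γ →
      HasDensityBoundedBy Γ β → 1 - δ ≤ (L.historyLaw I Γ L.samples).real
        {h | I.opt Γ - 16 * ε ≤ I.expectedUtility Γ (L.output h)} := by
  have hR' : (0 : ℝ) < R := by exact_mod_cast hR
  obtain ⟨t, htT, v, hv⟩ := exists_design (fun g => I.cellUtility K (I.tiltedContract N g))
    (fun g k => I.abs_principalUtility_le_one _ _) hε hε1 T (by simpa using hdesign)
  choose a w hrep haw using hv
  -- The contract posted in each round, and the weight of the round in the estimate for `g`.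
  set q : ℕ → Contract m := fun s =>
    if hs : s < t * R then I.tiltedContract N (v (Fin.divNat ⟨s, hs⟩))
    else I.tiltedContract N 0 with hq
  set x : (Fin m → Fin (N ^ 2 + 1)) → ℕ → ℝ := fun g s =>
    if hs : s < t * R then a g (Fin.divNat ⟨s, hs⟩) / R else 0 with hx
  have hqval : ∀ s : Fin (t * R), q s = I.tiltedContract N (v s.divNat) := fun s => by
    simp [hq]
  have hxval : ∀ g (s : Fin (t * R)), x g s = a g s.divNat / R := fun g s => by
    simp [hx]
  have hxsq : ∀ g, ∑ s : Fin (t * R), x g s ^ 2 ≤ ε ^ 2 / R := fun g => by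
    have hw0 : 0 ≤ ∑ k, w g k ^ 2 := Finset.sum_nonneg fun k _ => sq_nonneg _
    simp_rw [hxval]
    rw [sum_divNat (fun i => (a g i / R) ^ 2)]
    simp_rw [div_pow]
    rw [← Finset.sum_div, le_div_iff₀ hR']
    calc (R : ℝ) * ((∑ i, a g i ^ 2) / R ^ 2) * R = ∑ i, a g i ^ 2 := by field_simp
      _ ≤ ε ^ 2 := by linarith [haw g]
  set est : (Fin m → Fin (N ^ 2 + 1)) → (Fin (t * R) → Fin m) → ℝ := fun g h =>
    ∑ s : Fin (t * R), x g s * (I.r (h s) - (q s).1 (h s)) with hest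
  have hmax : ∀ h, ∃ g, ∀ g', est g' h ≤ est g h := fun h => Finite.exists_max fun g => est g h
  choose best hbest using hmax
  refine ⟨⟨fun s _ => q s, t * R, fun h => I.tiltedContract N (best h)⟩,
    Nat.mul_le_mul_right R htT, fun Γ _ hΓ => ?_⟩
  set L : Learner m := ⟨fun s _ => q s, t * R, fun h => I.tiltedContract N (best h)⟩
  set U : (Fin m → Fin (N ^ 2 + 1)) → ℝ := fun g => I.expectedUtility Γ (I.tiltedContract N g)
  have hbias' : ∀ g, |∑ s : Fin (t * R), x g s * I.expectedUtility Γ (q s) - U g| ≤ 3 * ε := by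
    intro g
    have h1 := I.abs_sum_expectedUtility_sub_le hΓ hK hε.le (I.tiltedContract N g)
      (fun i => I.tiltedContract N (v i)) (a g) (w g) (hrep g) (haw g)
    have h2 : ∑ s : Fin (t * R), x g s * I.expectedUtility Γ (q s) =
        ∑ i, a g i * I.expectedUtility Γ (I.tiltedContract N (v i)) := by
      simp_rw [hxval, hqval]
      rw [sum_divNat (fun i => a g i / R * I.expectedUtility Γ (I.tiltedContract N (v i))),
        Finset.mul_sum]
      refine Finset.sum_congr rfl fun i _ => ?_
      field_simp
    have herr0 : 0 ≤ 2 * n * β / K :=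
      (abs_nonneg _).trans (I.abs_expectedUtility_sub_le hΓ hK (q 0))
    rw [h2]
    refine h1.trans ?_
    have hsqrt : √(t : ℝ) ≤ √T := Real.sqrt_le_sqrt (by exact_mod_cast htT)
    have h3 : (√t * ε + 1) * (2 * n * β / K) ≤ (√T * ε + 1) * (2 * n * β / K) := by gcongr
    linarith
  set Z : (Fin m → Fin (N ^ 2 + 1)) → (Fin (t * R) → Fin m) → ℝ := fun g h =>
    ∑ s : Fin (t * R), x g s * (I.r (h s) - (q s).1 (h s) - I.expectedUtility Γ (q s)) with hZ
  have hgood : ∀ h, (∀ g, |Z g h| < ε) →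
      I.opt Γ - 16 * ε ≤ I.expectedUtility Γ (L.output h) := by
    intro h hh
    have hdev : ∀ g, |est g h - U g| ≤ 4 * ε := fun g => by
      have h1 : Z g h = est g h - ∑ s : Fin (t * R), x g s * I.expectedUtility Γ (q s) := by
        simp only [hZ, hest]
        rw [← Finset.sum_sub_distrib]
        exact Finset.sum_congr rfl fun s _ => mul_sub _ _ _
      have h2 := abs_lt.1 (hh g)
      have h3 := abs_le.1 (hbias' g)
      rw [abs_le]
      constructor <;> linarith
    rw [sub_le_iff_le_add]
    have : Nonempty (Contract m) := ⟨q 0⟩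
    refine ciSup_le fun p => ?_
    obtain ⟨g, hg⟩ := I.exists_tiltedContract_ge hN p
    have h1 : I.expectedUtility Γ p - 2 / N ≤ U g := by
      have := integral_mono ((I.integrable_principalUtility_response Γ p).sub
        (integrable_const (2 / (N : ℝ)))) (I.integrable_principalUtility_response Γ _) hg
      simp only [Pi.sub_apply] at this
      rw [integral_sub (I.integrable_principalUtility_response Γ p) (integrable_const _)] at this
      simpa [U, expectedUtility] using this
    have h2 := abs_le.1 (hdev g)
    have h3 := abs_le.1 (hdev (best h))
    have h4 := hbest h g
    change _ ≤ U (best h) + _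
    linarith
  have hsub : {h | I.opt Γ - 16 * ε ≤ I.expectedUtility Γ (L.output h)}ᶜ ⊆
      ⋃ g, ({h | ε ≤ Z g h} ∪ {h | ε ≤ ∑ s : Fin (t * R),
        -x g s * (I.r (h s) - (q s).1 (h s) - I.expectedUtility Γ (q s))}) := by
    intro h hh
    by_contra hcon
    refine hh (hgood h fun g => ?_)
    simp only [Set.mem_iUnion, Set.mem_union, Set.mem_ofPred_eq, not_exists, not_or, not_le,
      neg_mul, Finset.sum_neg_distrib] at hcon
    exact abs_lt.2 ⟨by linarith [(hcon g).2], (hcon g).1⟩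
  have htail : ∀ y : ℕ → ℝ, ∑ s : Fin (t * R), y s ^ 2 ≤ ε ^ 2 / R →
      (L.historyLaw I Γ (t * R)).real {h | ε ≤ ∑ s : Fin (t * R),
        y s * (I.r (h s) - (q s).1 (h s) - I.expectedUtility Γ (q s))} ≤
      Real.exp (-(R / 2 : ℝ)) := fun y hy => by
    refine (Learner.historyLaw_real_le I (L := L) (fun _ _ => rfl) Γ y (t * R) (by positivity)
      hε.le hy).trans_eq ?_
    congr 2
    field_simp
  have hbad : (L.historyLaw I Γ (t * R)).real
      {h | I.opt Γ - 16 * ε ≤ I.expectedUtility Γ (L.output h)}ᶜ ≤ δ := by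
    refine (measureReal_mono hsub).trans ((measureReal_iUnion_fintype_le _).trans
      (le_trans ?_ hnoise))
    refine (Finset.sum_le_sum (g := fun _ => 2 * Real.exp (-(R / 2 : ℝ))) fun g _ =>
      (measureReal_union_le _ _).trans ?_).trans_eq ?_
    · rw [two_mul]
      exact add_le_add (htail (x g) (hxsq g)) (htail (fun s => -x g s) (by simpa using hxsq g))
    · simp
  rw [probReal_compl_eq_one_sub (Set.toFinite _).measurableSet] at hbad
  change 1 - δ ≤ (L.historyLaw I Γ (t * R)).real _
  linarith

/-! ### Choice of the parameters -/

/-- With `K` cells, of order `log Y * Y ^ 2`, and a design of size `T`, of order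
`K * log Y / η ^ 2`, the bias of the estimates is at most `η / 8`. The powers of `Y` in the proof
are crude polynomial bounds that enter only through their logarithms. -/
theorem exists_design_parameters {η Y : ℝ} (hη : 0 < η) (hη2 : η < 2) (hY : 2 ≤ Y)
    (hηY : 1 / η ≤ Y) :
    ∃ K T : ℕ, 0 < K ∧
      2 * ((K + 1 : ℕ) * Real.log ((K + 1 : ℕ) * (1 + T))) < T * (η / 16) ^ 2 ∧
      (∀ x, x ≤ Y * η → (√T * (η / 16) + 1) * (2 * x / K) ≤ 2 * (η / 16)) ∧
      T ≤ 33032 * 266256 * (Real.log Y ^ 2 * Y ^ 2 / η ^ 2) := by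
  obtain ⟨ℓ, hℓ⟩ : ∃ ℓ, ℓ = Real.log Y := ⟨_, rfl⟩
  obtain ⟨E, hE⟩ : ∃ E, E = 1 / η := ⟨_, rfl⟩
  have hY0 : 0 < Y := by linarith
  have hE0 : 0 < E := by rw [hE]; positivity
  have hEη : E * η = 1 := by rw [hE]; field_simp
  have hEY : E ≤ Y := by rwa [hE]
  have hE2 : 1 / 2 ≤ E := by
    rw [hE]
    exact one_div_le_one_div_of_le hη hη2.le
  have hℓ2 : 1 / 2 ≤ ℓ := by
    have h1 := Real.log_le_log (by norm_num) hY
    linarith [Real.log_two_gt_d9]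
  have hℓY : ℓ ≤ Y := hℓ ▸ (Real.log_le_sub_one_of_pos hY0).trans (by linarith)
  have hpow2 : ∀ k : ℕ, (2 : ℝ) ^ k ≤ Y ^ k := fun k => pow_le_pow_left₀ (by norm_num) hY k
  obtain ⟨K, hKge, hKle⟩ : ∃ K : ℕ, 266240 * (ℓ * Y ^ 2) ≤ K ∧ K ≤ 266240 * (ℓ * Y ^ 2) + 1 :=
    ⟨_, Nat.le_ceil _, (Nat.ceil_lt_add_one (by positivity)).le⟩
  have hℓY2 : 2 ≤ ℓ * Y ^ 2 := by nlinarith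
  have hK1 : (1 : ℝ) ≤ K := by linarith
  obtain ⟨d, hd⟩ : ∃ d : ℝ, d = K + 1 := ⟨_, rfl⟩
  have hd1 : 1 ≤ d := by linarith
  obtain ⟨T, hTge, hTle⟩ : ∃ T : ℕ, 33024 * (d * ℓ * E ^ 2) ≤ T ∧
      T ≤ 33024 * (d * ℓ * E ^ 2) + 1 :=
    ⟨_, Nat.le_ceil _, (Nat.ceil_lt_add_one (by positivity)).le⟩
  have hdℓ : 1 / 2 ≤ d * ℓ := by nlinarith
  have hdY : d ≤ Y ^ 22 := by
    have h1 : ℓ * Y ^ 2 ≤ Y * Y ^ 2 := mul_le_mul_of_nonneg_right hℓY (by positivity)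
    have h2 : (1 : ℝ) ≤ Y ^ 3 := one_le_pow₀ (by linarith)
    calc d ≤ 2 ^ 19 * Y ^ 3 := by linarith
      _ ≤ Y ^ 19 * Y ^ 3 := mul_le_mul_of_nonneg_right (hpow2 19) (by positivity)
      _ = Y ^ 22 := by ring
  have hTY : 1 + (T : ℝ) ≤ Y ^ 41 := by
    have h1 : d * ℓ * E ^ 2 ≤ Y ^ 22 * Y * Y ^ 2 := by gcongr
    have h2 : (1 : ℝ) ≤ Y ^ 25 := one_le_pow₀ (by linarith)
    calc 1 + (T : ℝ) ≤ 2 ^ 16 * Y ^ 25 := by linarith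
      _ ≤ Y ^ 16 * Y ^ 25 := mul_le_mul_of_nonneg_right (hpow2 16) (by positivity)
      _ = Y ^ 41 := by ring
  have hTε : 129 * (d * ℓ) ≤ T * (η / 16) ^ 2 := by
    calc 129 * (d * ℓ) = 33024 * (d * ℓ * E ^ 2) * (η / 16) ^ 2 := by
          linear_combination (-129 * d * ℓ * (E * η + 1)) * hEη
      _ ≤ _ := mul_le_mul_of_nonneg_right hTge (by positivity)
  have hTε' : T * (η / 16) ^ 2 ≤ 129 * (d * ℓ) + 1 := by
    calc (T : ℝ) * (η / 16) ^ 2 ≤ (33024 * (d * ℓ * E ^ 2) + 1) * (η / 16) ^ 2 :=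
          mul_le_mul_of_nonneg_right hTle (by positivity)
      _ = 129 * (d * ℓ) + (η / 16) ^ 2 := by
          linear_combination (129 * d * ℓ * (E * η + 1)) * hEη
      _ ≤ _ := by nlinarith
  refine ⟨K, T, by exact_mod_cast hK1, ?_, fun x hx => ?_, ?_⟩
  · have hlog : Real.log (d * (1 + T)) ≤ 63 * ℓ := by
      have h1 : d * (1 + T) ≤ Y ^ 63 := by
        calc d * (1 + T) ≤ Y ^ 22 * Y ^ 41 := by gcongr
          _ = Y ^ 63 := by ring
      have h2 := Real.log_le_log (by positivity) h1
      rw [Real.log_pow, ← hℓ] at h2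
      exact_mod_cast h2
    have h3 : d * Real.log (d * (1 + T)) ≤ d * (63 * ℓ) :=
      mul_le_mul_of_nonneg_left hlog (by linarith)
    rw [Nat.cast_add_one, ← hd]
    linarith
  · obtain ⟨s, hs⟩ : ∃ s : ℝ, s = √T * (η / 16) := ⟨_, rfl⟩
    have hs0 : 0 ≤ s := by rw [hs]; positivity
    have hs2 : s ^ 2 = T * (η / 16) ^ 2 := by rw [hs, mul_pow, Real.sq_sqrt (Nat.cast_nonneg T)]
    have h1 : (s + 1) ^ 2 ≤ 532 * (K * ℓ) := by
      have h2 : (s + 1) ^ 2 ≤ 2 * s ^ 2 + 2 := by linarith [sq_nonneg (s - 1)]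
      have h3 : d * ℓ ≤ 2 * K * ℓ := mul_le_mul_of_nonneg_right (by linarith) (by linarith)
      linarith
    have h4 : (s + 1) * (16 * Y) ≤ K := by
      refine abs_le_of_sq_le_sq' ?_ (by positivity) |>.2
      calc ((s + 1) * (16 * Y)) ^ 2 = (s + 1) ^ 2 * (256 * Y ^ 2) := by ring
        _ ≤ 532 * (K * ℓ) * (256 * Y ^ 2) := mul_le_mul_of_nonneg_right h1 (by positivity)
        _ = K * (136192 * (ℓ * Y ^ 2)) := by ring
        _ ≤ K * K := mul_le_mul_of_nonneg_left (by linarith) (by linarith)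
        _ = (K : ℝ) ^ 2 := by ring
    rw [← hs, ← mul_div_assoc, div_le_iff₀ (by linarith)]
    calc (s + 1) * (2 * x) ≤ (s + 1) * (2 * (Y * η)) :=
          mul_le_mul_of_nonneg_left (by linarith) (by linarith)
      _ = (s + 1) * (16 * Y) * (2 * (η / 16)) := by ring
      _ ≤ K * (2 * (η / 16)) := mul_le_mul_of_nonneg_right h4 (by positivity)
      _ = 2 * (η / 16) * K := by ring
  · have hdle : d ≤ 266256 * (ℓ * Y ^ 2) := by linarith
    have h3 : 1 / 4 ≤ E ^ 2 := by nlinarith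
    have h5 : 1 / 2 * (1 / 4) ≤ d * ℓ * E ^ 2 := mul_le_mul hdℓ h3 (by norm_num) (by linarith)
    calc (T : ℝ) ≤ 33032 * (d * ℓ * E ^ 2) := by linarith
      _ ≤ 33032 * (266256 * (ℓ * Y ^ 2) * ℓ * E ^ 2) := by gcongr
      _ = 33032 * 266256 * (Real.log Y ^ 2 * Y ^ 2 / η ^ 2) := by
          rw [hE, ← hℓ]
          ring

/-- Resolution `N` of the candidate contracts, and number `R` of repetitions that suffices for a
union bound over the `(N ^ 2 + 1) ^ m` candidates. -/
theorem exists_estimation_parameters {m : ℕ} {η δ Y : ℝ} (hm : 1 ≤ m) (hη : 0 < η) (hδ : 0 < δ)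
    (hδ1 : δ ≤ 1) (hY : 2 ≤ Y) (hηY : 1 / η ≤ Y) :
    ∃ N R : ℕ, 0 < N ∧ 0 < R ∧ 2 / (N : ℝ) ≤ 4 * (η / 16) ∧
      ((N : ℝ) ^ 2 + 1) ^ m * (2 * Real.exp (-(R / 2 : ℝ))) ≤ δ ∧
      R ≤ 44 * (m * Real.log Y * Real.log (2 / δ)) := by
  obtain ⟨ℓ, hℓ⟩ : ∃ ℓ, ℓ = Real.log Y := ⟨_, rfl⟩
  obtain ⟨Λ, hΛ⟩ : ∃ Λ, Λ = Real.log (2 / δ) := ⟨_, rfl⟩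
  have hY0 : 0 < Y := by linarith
  have hm' : (1 : ℝ) ≤ m := by exact_mod_cast hm
  have hlog2 : (1 : ℝ) / 2 ≤ Real.log 2 := by linarith [Real.log_two_gt_d9]
  have hℓ2 : 1 / 2 ≤ ℓ := hℓ ▸ hlog2.trans (Real.log_le_log (by norm_num) hY)
  have hΛ2 : 1 / 2 ≤ Λ := by
    rw [hΛ]
    refine hlog2.trans (Real.log_le_log (by norm_num) ?_)
    rw [le_div_iff₀ hδ]
    linarith
  obtain ⟨N, hNge, hNle⟩ : ∃ N : ℕ, 8 * (1 / η) ≤ N ∧ N ≤ 8 * (1 / η) + 1 :=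
    ⟨_, Nat.le_ceil _, (Nat.ceil_lt_add_one (by positivity)).le⟩
  obtain ⟨R, hRge, hRle⟩ : ∃ R : ℕ, 2 * (9 * m * ℓ + Λ) ≤ R ∧ R ≤ 2 * (9 * m * ℓ + Λ) + 1 :=
    ⟨_, Nat.le_ceil _, (Nat.ceil_lt_add_one (by positivity)).le⟩
  have hN0 : (0 : ℝ) < N := lt_of_lt_of_le (by positivity) hNge
  have hmℓ : 1 / 2 ≤ m * ℓ := by nlinarith
  refine ⟨N, R, by exact_mod_cast hN0, ?_, ?_, ?_, ?_⟩
  · have : (0 : ℝ) < R := by linarith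
    exact_mod_cast this
  · rw [div_le_iff₀ hN0]
    calc 2 = 4 * (η / 16) * (8 * (1 / η)) := by field_simp; norm_num
      _ ≤ _ := mul_le_mul_of_nonneg_left hNge (by positivity)
  · have h1 : (N : ℝ) ^ 2 + 1 ≤ Y ^ 9 := by
      have h3 : (N : ℝ) ^ 2 ≤ (9 * Y) ^ 2 := pow_le_pow_left₀ hN0.le (by linarith) 2
      calc (N : ℝ) ^ 2 + 1 ≤ 2 ^ 7 * Y ^ 2 := by nlinarith
        _ ≤ Y ^ 7 * Y ^ 2 :=
          mul_le_mul_of_nonneg_right (pow_le_pow_left₀ (by norm_num) hY 7) (by positivity)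
        _ = Y ^ 9 := by ring
    have h4 : ((N : ℝ) ^ 2 + 1) ^ m ≤ Real.exp (9 * m * ℓ) := by
      calc ((N : ℝ) ^ 2 + 1) ^ m ≤ (Y ^ 9) ^ m := by gcongr
        _ = Real.exp ((9 * m : ℕ) * ℓ) := by
            rw [← pow_mul, Real.exp_nat_mul, hℓ, Real.exp_log hY0]
        _ = Real.exp (9 * m * ℓ) := by push_cast; rfl
    have h5 : Real.exp (-Λ) = δ / 2 := by
      rw [hΛ, Real.exp_neg, Real.exp_log (by positivity), inv_div]
    calc ((N : ℝ) ^ 2 + 1) ^ m * (2 * Real.exp (-(R / 2 : ℝ)))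
        ≤ Real.exp (9 * m * ℓ) * (2 * Real.exp (-(9 * m * ℓ) + -Λ)) := by
          gcongr
          linarith
      _ = δ := by
          rw [Real.exp_add, h5, Real.exp_neg]
          field_simp
  · have h4 : m * ℓ * (1 / 2) ≤ m * ℓ * Λ := mul_le_mul_of_nonneg_left hΛ2 (by linarith)
    have h5 : 1 / 2 * Λ ≤ m * ℓ * Λ := mul_le_mul_of_nonneg_right hmℓ (by linarith)
    rw [← hℓ, ← hΛ]
    linarith

/-- The parameters of the learner can be chosen within the sample bound. -/
theorem exists_parameters {n m : ℕ} {β η δ : ℝ} (hn : 1 ≤ n) (hm : 1 ≤ m) (hβ : 1 ≤ β)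
    (hη : 0 < η) (hη2 : η < 2) (hδ : 0 < δ) (hδ1 : δ ≤ 1) :
    ∃ K N T R : ℕ, 0 < K ∧ 0 < N ∧ 0 < R ∧
      2 * ((K + 1 : ℕ) * Real.log ((K + 1 : ℕ) * (1 + T))) < T * (η / 16) ^ 2 ∧
      (√T * (η / 16) + 1) * (2 * n * β / K) ≤ 2 * (η / 16) ∧
      2 / (N : ℝ) ≤ 4 * (η / 16) ∧
      ((N : ℝ) ^ 2 + 1) ^ m * (2 * Real.exp (-(R / 2 : ℝ))) ≤ δ ∧
      (T : ℝ) * R ≤ 10 ^ 14 * (β * n * m) ^ 3 / η ^ 4 *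
        Real.log (2 + β * n * m / η) ^ 3 * Real.log (2 / δ) := by
  have hn' : (1 : ℝ) ≤ n := by exact_mod_cast hn
  have hm' : (1 : ℝ) ≤ m := by exact_mod_cast hm
  have hβn : 1 ≤ β * n := one_le_mul_of_one_le_of_one_le hβ hn'
  have hβnm : 1 ≤ β * n * m := one_le_mul_of_one_le_of_one_le hβn hm'
  obtain ⟨b, hb⟩ : ∃ b, b = β * n * m := ⟨_, rfl⟩
  have hmb : (m : ℝ) ≤ b := hb ▸ le_mul_of_one_le_left (by linarith) hβn
  have hnb : n * β ≤ b := by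
    rw [hb, mul_comm (n : ℝ)]
    exact le_mul_of_one_le_right (by linarith) hm'
  have hb1 : 1 ≤ b := hb ▸ hβnm
  rw [← hb]
  have hηb : 1 / η ≤ b / η := div_le_div_of_nonneg_right hb1 hη.le
  have hη_inv : 1 / 2 ≤ 1 / η := one_div_le_one_div_of_le hη hη2.le
  have hY : 2 ≤ 2 + b / η := by linarith
  have hηY : 1 / η ≤ 2 + b / η := by linarith
  obtain ⟨K, T, hK, hdesign, hbias, hT⟩ := exists_design_parameters hη hη2 hY hηY
  obtain ⟨N, R, hN, hR, hgrid, hnoise, hRle⟩ := exists_estimation_parameters hm hη hδ hδ1 hY hηY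
  refine ⟨K, N, T, R, hK, hN, hR, hdesign, ?_, hgrid, hnoise, ?_⟩
  · rw [mul_assoc 2]
    refine hbias _ ?_
    calc n * β ≤ b / η * η := by rwa [div_mul_cancel₀ _ hη.ne']
      _ ≤ _ := mul_le_mul_of_nonneg_right (by linarith) hη.le
  · have hℓ : 0 ≤ Real.log (2 + b / η) := Real.log_nonneg (by linarith)
    have hΛ : 0 ≤ Real.log (2 / δ) := Real.log_nonneg (by rw [le_div_iff₀ hδ]; linarith)
    have hY5 : 2 + b / η ≤ 5 * (b / η) := by linarith
    have hY0 : 0 ≤ 2 + b / η := by linarith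
    generalize Real.log (2 + b / η) = ℓ at *
    generalize Real.log (2 / δ) = Λ at *
    calc (T : ℝ) * R
        ≤ 33032 * 266256 * (ℓ ^ 2 * (5 * (b / η)) ^ 2 / η ^ 2) * (44 * (b * ℓ * Λ)) := by
          refine mul_le_mul (hT.trans ?_) (hRle.trans ?_) (Nat.cast_nonneg R) (by positivity)
          · gcongr
          · gcongr
      _ = 33032 * 266256 * 25 * 44 * (b ^ 3 / η ^ 4 * ℓ ^ 3 * Λ) := by
          field_simp
          ring
      _ ≤ 10 ^ 14 * (b ^ 3 / η ^ 4 * ℓ ^ 3 * Λ) := by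
          have : 0 ≤ b := by linarith
          exact mul_le_mul_of_nonneg_right (by norm_num) (by positivity)
      _ = _ := by ring

/-- Without samples the guarantee holds trivially when `η` is at least the length of the range of
the utilities. -/
theorem Instance.opt_sub_two_le {n m : ℕ} (I : Instance n m) (Γ : Measure ℝ)
    [IsProbabilityMeasure Γ] (p : Contract m) : I.opt Γ - 2 ≤ I.expectedUtility Γ p := by
  have : Nonempty (Contract m) := ⟨p⟩
  have h : I.opt Γ ≤ 1 := ciSup_le fun q => (abs_le.1 (I.abs_expectedUtility_le_one Γ q)).2
  linarith [(abs_le.1 (I.abs_expectedUtility_le_one Γ p)).1]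

end ContractDesign

theorem theorem5 :
    ∃ (C : ℝ) (a b : ℕ), 0 < C ∧
      ∀ (n m : ℕ) (I : ContractDesign.Instance n m) (β η δ : ℝ),
        0 < β → 0 < η → 0 < δ → δ ≤ 1 →
        ∃ L : ContractDesign.Learner m,
          (L.samples : ℝ) ≤
            C * (β * n * m) ^ a / η ^ 4 * Real.log (2 + β * n * m / η) ^ b * Real.log (2 / δ) ∧
          ∀ Γ : MeasureTheory.Measure ℝ, MeasureTheory.IsProbabilityMeasure Γ →
            ContractDesign.HasDensityBoundedBy Γ β →
            1 - δ ≤ (L.historyLaw I Γ L.samples).real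
              {h | I.opt Γ - η ≤ I.expectedUtility Γ (L.output h)} := by
  refine ⟨10 ^ 14, 3, 3, by norm_num, fun n m I β η δ hβ hη hδ hδ1 => ?_⟩
  by_cases hcase : 1 ≤ β ∧ η < 2
  · obtain ⟨a₀, -⟩ := I.exists_null
    have hn : 1 ≤ n := a₀.pos
    have hm : 1 ≤ m := by
      by_contra! hm
      obtain rfl : m = 0 := by omega
      simpa using I.F_sum a₀
    obtain ⟨K, N, T, R, hK, hN, hR, hdesign, hbias, hgrid, hnoise, hsamples⟩ :=
      ContractDesign.exists_parameters hn hm hcase.1 hη hcase.2 hδ hδ1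
    obtain ⟨L, hL, hΓ⟩ := I.exists_learner (by positivity) (by linarith [hcase.2]) hK hN hR
      hdesign hbias hgrid hnoise
    refine ⟨L, le_trans ?_ hsamples, fun Γ _ h => ?_⟩
    · exact_mod_cast hL
    · simpa [mul_div_cancel₀] using hΓ Γ ‹_› h
  · -- There is no admissible type distribution if `β < 1`, and every contract is good enough if
    -- `2 ≤ η`; so no samples are needed.
    have p : ContractDesign.Contract m := ⟨fun _ => 0, fun _ => by simp⟩
    refine ⟨⟨fun _ _ => p, 0, fun _ => p⟩, ?_, fun Γ _ h => ?_⟩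
    · have h1 : 0 ≤ Real.log (2 + β * n * m / η) :=
        Real.log_nonneg (by linarith [show 0 ≤ β * n * m / η by positivity])
      have h2 : 0 ≤ Real.log (2 / δ) :=
        Real.log_nonneg (by rw [le_div_iff₀ hδ]; linarith)
      simp only [Nat.cast_zero]
      positivity
    · have hη2 : 2 ≤ η := by
        by_contra! hlt
        exact hcase ⟨h.one_le, hlt⟩
      have hall : {h : Fin 0 → Fin m | I.opt Γ - η ≤ I.expectedUtility Γ p} = Set.univ :=
        Set.eq_univ_of_forall fun _ => by
          have := I.opt_sub_two_le Γ p
          exact (sub_le_sub_left hη2 _).trans this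
      rw [hall, probReal_univ]
      linarith
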